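/- Let $F$ be a number field, $S=\operatorname{Spec}\mathfrak o_F$, and let $G$ be a flat affine $S$-group scheme of finite type with geometrically connected fibres. For every $\sigma\in S(\mathbf C)$ (that is, every embedding $\sigma:F\to\mathbf C$), fix a maximal compact subgroup $K_\sigma$ of $G_\sigma(\mathbf C)$, and put $\mathbf K=(K_\sigma)_\sigma$. Let $\mathcal X$ be a flat $S$-scheme with an action of $G$ and $\mathcal B$ a flat $S$-scheme. Let $\widehat{\mathcal T}$ be an arithmetic $(G,\mathbf K)$-torsor on $\mathcal B$: a $G$-torsor $\mathcal T\to\mathcal B$, locally trivial for the Zariski topology, together with, for every $\sigma$, a continuous reduction to $K_\sigma$ of the structure group of $\mathcal T_\sigma(\mathbf C)\to\mathcal B_\sigma(\mathbf C)$; the reduction singles out, locally for the complex topology, $K_\sigma$-admissible trivializations of the torsor, whose transition functions take values in $K_\sigma$. Let $(\tau_i)$ be the local sections of $\mathcal T$ over the Zariski open subsets $U_i$ of $\mathcal B$, with $\tau_i=g_{ij}\tau_j$, $g_{ij}\in G(U_i\cap U_j)$. Let $\pi:\mathcal Y\to\mathcal B$ be the $\mathcal B$-scheme obtained by gluing the $\mathcal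 X\times_S U_i$ along $(x,u)\mapsto(g_{ij}(u)\cdot x,u)$, from the $j$-th to the $i$-th piece over $U_i\cap U_j$ (and likewise for the gluings below). For a $G$-linearized line bundle $\mathcal L$ on $\mathcal X$ (identified with its total space, on which $G$ acts), let $\vartheta(\mathcal L)$ be the line bundle on $\mathcal Y$ obtained by gluing the $\mathcal L\times_S U_i$ along $(v,u)\mapsto(g_{ij}(u)\cdot v,u)$. If $\mathcal L$ carries $K_\sigma$-invariant Hermitian metrics for all $\sigma$, then $\vartheta(\mathcal L)$ carries the Hermitian metrics which, in the $K_\sigma$-admissible trivializations of the torsor over open subsets $U$ of $\mathcal B_\sigma(\mathbf C)$, are the inverse images on $\mathcal L_\sigma(\mathbf C)\times U$ of the metric of $\mathcal L$. Let $\chi: G\to\mathbf G_m$ be a character. Let $\iota(\chi)$ be the trivial line bundle $\mathbf A^1\times\mathcal X$ on $\mathcal X$ with the linearization $g\cdot(t,x)=(\chi(g)t,g\cdot x)$ and the metrics $\|(t,x)\|=|t|$, which are $K_\sigma$-invariant. Let $\eta_{\mathcal T}(\chi)$ be the line bundle on $\mathcal B$ obtained by gluing the $\mathbf A^1\times U_i$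 along $(t,u)\mapsto(\chi(g_{ij}(u))t,u)$, with the Hermitian metrics given by $|t|$ in the $K_\sigma$-admissible trivializations of the torsor. Then there is exactly one isomorphism of line bundles on $\mathcal Y$ $$\vartheta(\iota(\chi))\;\simeq\;\pi^*\eta_{\mathcal T}(\chi)$$ which for every $i$ is the identity of $\mathbf A^1\times\mathcal X\times U_i$ in the charts of both sides over $\pi^{-1}(U_i)\simeq\mathcal X\times U_i$, and this canonical isomorphism is an isometry for every $\sigma\in S(\mathbf C)$, where $\pi^*\eta_{\mathcal T}(\chi)$ carries the inverse image of the metrics of $\eta_{\mathcal T}(\chi)$. -/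

import Mathlib

open CategoryTheory Limits AlgebraicGeometry MonoidalCategory CartesianMonoidalCategory MonObj
noncomputable section
namespace TorsorTwist
variable {S : Scheme.{0}}

/-- The ring of global functions on an `S`-scheme `W`. -/
abbrev Fn (W : Over S) : Type := Γ(W.left, ⊤)

/-- Pull-back of functions. -/
def res {W W' : Over S} (f : W' ⟶ W) : Fn W →+* Fn W' := f.left.appTop.hom

lemma res_comp {W W' W'' : Over S} (f' : W'' ⟶ W') (f : W' ⟶ W) (a : Fn W) :
    res (f' ≫ f) a = res f' (res f a) := by
  change (f' ≫ f).left.appTop.hom a = _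
  rw [Over.comp_left, Scheme.Hom.comp_appTop]; rfl

lemma res_id {W : Over S} (a : Fn W) : res (𝟙 W) a = a := by
  simp [res]

/-- A (left) action over `S` of the `S`-group scheme `G` on the `S`-scheme `X`, given on points with
values in all `S`-schemes `W`, functorially in `W`. By the Yoneda lemma this is the same as a
morphism `G ×_S X ⟶ X` satisfying the axioms of an action. -/
structure GAction (G X : Over S) [GrpObj G] where
  smul : ∀ {W : Over S}, (W ⟶ G) → (W ⟶ X) → (W ⟶ X)
  comp_smul : ∀ {W W' : Over S} (f : W' ⟶ W) (g : W ⟶ G) (x : W ⟶ X),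
    f ≫ smul g x = smul (f ≫ g) (f ≫ x)
  one_smul : ∀ {W : Over S} (x : W ⟶ X), smul 1 x = x
  mul_smul : ∀ {W : Over S} (g h : W ⟶ G) (x : W ⟶ X), smul (g * h) x = smul g (smul h x)

/-- An open subscheme of `B`, as an `S`-scheme. -/
abbrev opn (B : Over S) (U : B.left.Opens) : Over S := Over.mk (U.ι ≫ B.hom)

/-- The inclusion of an open subscheme. -/
def incl (B : Over S) (U : B.left.Opens) : opn B U ⟶ B := Over.homMk U.ι

/-- The inclusion of an open subscheme in a larger one. -/
def inclLE (B : Over S) {U V : B.left.Opens} (h : U ≤ V) : opn B U ⟶ opn B V :=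
  Over.homMk (B.left.homOfLE h) (by simp [opn])

@[simp]
lemma inclLE_incl (B : Over S) {U V : B.left.Opens} (h : U ≤ V) :
    inclLE B h ≫ incl B V = incl B U := by
  ext1; simp [inclLE, incl]

@[simp]
lemma inclLE_incl_assoc (B : Over S) {U V : B.left.Opens} (h : U ≤ V) {Z : Over S} (f : B ⟶ Z) :
    inclLE B h ≫ incl B V ≫ f = incl B U ≫ f := by
  rw [← Category.assoc, inclLE_incl]

instance (B : Over S) (U : B.left.Opens) : Mono (incl B U) := by
  have : Mono ((Over.forget S).map (incl B U)) := by
    dsimp [incl]; infer_instance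
  exact (Over.forget S).mono_of_mono_map this

lemma map_cover_f {B : Scheme.{0}} {𝒰 : B.OpenCover} [Category 𝒰.I₀] [𝒰.LocallyDirected]
    [Small.{0} 𝒰.I₀] [Quiver.IsThin 𝒰.I₀]
    (d : Scheme.Cover.RelativeGluingData 𝒰) {i j : 𝒰.I₀} (f : i ⟶ j) :
    d.functor.map f ≫ d.cover.f j = d.cover.f i := colimit.w d.functor f

/-- A `G`-torsor over the `S`-scheme `B` that is locally trivial for the Zariski topology: an
`S`-scheme over `B` with a `G`-action over `B` which is simply transitive on points with values in
any `S`-scheme over `B` (that is, `G ×_S T ≅ T ×_B T`), and which has sections locally on `B`. -/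
structure GTorsor (G B : Over S) [GrpObj G] where
  total : Over S
  act : GAction G total
  proj : total ⟶ B
  smul_proj : ∀ {W : Over S} (g : W ⟶ G) (t : W ⟶ total), act.smul g t ≫ proj = t ≫ proj
  existsUnique_smul : ∀ {W : Over S} (t t' : W ⟶ total), t ≫ proj = t' ≫ proj →
    ∃! g : W ⟶ G, act.smul g t = t'
  exists_section : ∀ b : B.left, ∃ U : B.left.Opens, b ∈ U ∧
    ∃ τ : opn B U ⟶ total, τ ≫ proj = incl B U

variable {G B : Over S} [GrpObj G]

namespace GTorsor
variable (T : GTorsor G B)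

/-- A local trivialization of the torsor: an open `U` of `B` with a section of `T` over `U`. -/
structure Triv where
  U : B.left.Opens
  sec : opn B U ⟶ T.total
  sec_proj : sec ≫ T.proj = incl B U

/-- Trivializations are (pre)ordered by inclusion of their domains only. -/
instance : Preorder T.Triv := Preorder.lift Triv.U

variable {T} in
lemma Triv.le_iff {i j : T.Triv} : i ≤ j ↔ i.U ≤ j.U := Iff.rfl

/-- The domain of a trivialization, as an `S`-scheme. -/
abbrev Triv.dom {T : GTorsor G B} (i : T.Triv) : Over S := opn B i.U

variable {T} in
/-- The unique `g` with `g • t' = t`, for two points of `T` over the same point of `B`. -/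
def div {W : Over S} (t t' : W ⟶ T.total) (h : t ≫ T.proj = t' ≫ T.proj) : W ⟶ G :=
  (T.existsUnique_smul t' t h.symm).choose

variable {T} in
lemma div_smul {W : Over S} (t t' : W ⟶ T.total) (h : t ≫ T.proj = t' ≫ T.proj) :
    T.act.smul (div t t' h) t' = t :=
  (T.existsUnique_smul t' t h.symm).choose_spec.1

variable {T} in
lemma eq_div {W : Over S} (t t' : W ⟶ T.total) (h : t ≫ T.proj = t' ≫ T.proj) (g : W ⟶ G)
    (hg : T.act.smul g t' = t) : g = div t t' h :=
  (T.existsUnique_smul t' t h.symm).unique hg (div_smul t t' h)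

variable {T}

/-- The transition function `g_ji : U_i ⟶ G` with `τ_j = g_ji • τ_i` on `U_i ⊆ U_j`. -/
def trans {i j : T.Triv} (h : i ≤ j) : i.dom ⟶ G :=
  div (inclLE B h ≫ j.sec) i.sec (by simp [Triv.sec_proj])

lemma trans_smul {i j : T.Triv} (h : i ≤ j) :
    T.act.smul (trans h) i.sec = inclLE B h ≫ j.sec := div_smul _ _ _

lemma trans_refl (i : T.Triv) : trans (le_refl i) = 1 := by
  symm
  apply eq_div
  rw [T.act.one_smul]
  have : inclLE B (le_refl i.U) = 𝟙 _ := by rw [← cancel_mono (incl B i.U)]; simp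
  erw [this]; simp

lemma trans_comp {i j k : T.Triv} (h : i ≤ j) (h' : j ≤ k) :
    (inclLE B h ≫ trans h') * trans h = trans (h.trans h') := by
  apply eq_div
  rw [T.act.mul_smul, trans_smul, ← T.act.comp_smul, trans_smul, ← Category.assoc]
  congr 1
  rw [← cancel_mono (incl B k.U)]; simp

/-- Restriction of a trivialization. -/
def restr (i : T.Triv) (U : B.left.Opens) (h : U ≤ i.U) : T.Triv where
  U := U
  sec := inclLE B h ≫ i.sec
  sec_proj := by simp [Triv.sec_proj]

variable (T) in
/-- The open cover of `B` by the domains of all trivializations of `T`. -/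
abbrev cover : B.left.OpenCover where
  I₀ := T.Triv
  X i := i.U
  f i := i.U.ι
  mem₀ := by
    rw [Scheme.presieve₀_mem_precoverage_iff]
    refine ⟨fun x ↦ ?_, fun i ↦ by dsimp; infer_instance⟩
    obtain ⟨U, hx, τ, hτ⟩ := T.exists_section x
    exact ⟨⟨U, τ, hτ⟩, by simpa using hx⟩

instance : Category T.cover.I₀ := inferInstanceAs (Category T.Triv)
instance : Quiver.IsThin T.cover.I₀ := inferInstanceAs (Quiver.IsThin T.Triv)

instance : T.cover.LocallyDirected where
  trans {i j} h := B.left.homOfLE (leOfHom h)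
  trans_id i := by simp [cover]
  trans_comp := by intros; simp
  w := by intros; simp [cover]
  directed {i j} x := by
    let k : T.Triv := restr i (i.U ⊓ j.U) inf_le_left
    have hki : k ≤ i := show i.U ⊓ j.U ≤ i.U from inf_le_left
    have hkj : k ≤ j := show i.U ⊓ j.U ≤ j.U from inf_le_right
    have hx : (pullback.fst (T.cover.f i) (T.cover.f j) ≫ T.cover.f i) x ∈ i.U ⊓ j.U := by
      refine ⟨?_, ?_⟩
      · exact (pullback.fst (T.cover.f i) (T.cover.f j) x).2
      · rw [pullback.condition]
        exact (pullback.snd (T.cover.f i) (T.cover.f j) x).2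
    have e : pullback.lift (B.left.homOfLE hki) (B.left.homOfLE hkj) (by simp) ≫
        (pullback.fst (T.cover.f i) (T.cover.f j) ≫ T.cover.f i) = k.U.ι := by
      rw [pullback.lift_fst_assoc, Scheme.homOfLE_ι]
    let y : (k.U : Scheme) := ⟨_, hx⟩
    refine ⟨k, homOfLE hki, homOfLE hkj, y, ?_⟩
    have : Mono (pullback.fst (T.cover.f i) (T.cover.f j) ≫ T.cover.f i) := inferInstance
    have hinj : Function.Injective
        (pullback.fst (T.cover.f i) (T.cover.f j) ≫ T.cover.f i) := Scheme.Hom.injective _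
    apply hinj
    exact (Scheme.Hom.comp_apply _ _ _).symm.trans (congrArg (fun φ ↦ φ y) e)
  property_trans {i j} h := inferInstanceAs (IsOpenImmersion (B.left.homOfLE (leOfHom h)))


variable {X : Over S} (a : GAction G X)

/-- The gluing map `X × U_i ⟶ X × U_j`, `(x, u) ↦ (g_ji(u) • x, u)`, for `U_i ⊆ U_j`. -/
def twMap {i j : T.Triv} (h : i ≤ j) : X ⊗ i.dom ⟶ X ⊗ j.dom :=
  lift (a.smul (snd _ _ ≫ trans h) (fst _ _)) (snd _ _ ≫ inclLE B h)

lemma lift_twMap {W : Over S} {i j : T.Triv} (h : i ≤ j) (x : W ⟶ X) (u : W ⟶ i.dom) :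
    lift x u ≫ twMap a h = lift (a.smul (u ≫ trans h) x) (u ≫ inclLE B h) := by
  simp [twMap, comp_lift, a.comp_smul]

lemma twMap_snd {i j : T.Triv} (h : i ≤ j) :
    twMap a h ≫ snd _ _ = snd _ _ ≫ inclLE B h := by
  simp [twMap]

lemma isPullback_twMap {i j : T.Triv} (h : i ≤ j) :
    IsPullback (twMap a h) (snd X i.dom) (snd X j.dom) (inclLE B h) := by
  refine ⟨⟨twMap_snd a h⟩, ⟨PullbackCone.IsLimit.mk _
    (fun s ↦ lift (a.smul (s.snd ≫ trans h)⁻¹ (s.fst ≫ fst _ _)) s.snd) (fun s ↦ ?_)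
    (fun s ↦ by simp) (fun s m h₁ h₂ ↦ ?_)⟩⟩
  · rw [lift_twMap, ← a.mul_smul, mul_inv_cancel, a.one_smul, ← s.condition]
    ext1 <;> simp
  · have hm : m = lift (m ≫ fst _ _) s.snd := by
      rw [← h₂]; ext1 <;> simp
    rw [hm] at h₁
    rw [lift_twMap] at h₁
    rw [← h₁, lift_fst, ← a.mul_smul, inv_mul_cancel, a.one_smul]
    exact hm

lemma twMap_refl (i : T.Triv) : twMap a (le_refl i) = 𝟙 (X ⊗ i.dom) := by
  have h : inclLE B (le_refl i.U) = 𝟙 _ := by rw [← cancel_mono (incl B i.U)]; simp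
  have h2 := lift_twMap a (le_refl i) (fst X i.dom) (snd X i.dom)
  rw [trans_refl, comp_one, a.one_smul] at h2
  simpa [h] using h2

lemma twMap_comp {i j k : T.Triv} (h : i ≤ j) (h' : j ≤ k) :
    twMap a (h.trans h') = twMap a h ≫ twMap a h' := by
  have e : inclLE B h ≫ inclLE B h' = inclLE B (h.trans h') := by
    rw [← cancel_mono (incl B k.U)]; simp
  rw [twMap, twMap, lift_twMap, ← a.mul_smul, Category.assoc, Category.assoc, e,
    ← trans_comp h h', comp_mul]

/-- The pieces `X × U_i` and the gluing maps between them. -/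
def twFunctor : T.cover.I₀ ⥤ Scheme.{0} where
  obj (i : T.Triv) := (X ⊗ i.dom).left
  map {i j} h := (twMap a (leOfHom h)).left
  map_id i := congrArg (fun f ↦ f.left) (twMap_refl a i)
  map_comp {i j k} f g := congrArg (fun f ↦ f.left) (twMap_comp a (leOfHom f) (leOfHom g))

variable (T) in
/-- The gluing datum over `B` of the pieces `X × U_i ⟶ U_i`. -/
def glueing : Scheme.Cover.RelativeGluingData T.cover where
  functor := twFunctor a
  natTrans :=
    { app := fun (i : T.Triv) ↦ (snd X i.dom).left
      naturality := fun i j h ↦ congrArg (fun f ↦ f.left) (twMap_snd a (leOfHom h)) }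
  equifibered {i j} h := (isPullback_twMap a (leOfHom h)).map (Over.forget S)

variable (T) in
/-- The twist of the `G`-scheme `X` by the torsor `T`: the `B`-scheme obtained by gluing the pieces
`X × U_i`, for all trivializations of `T`, along `(x, u) ↦ (g_ji(u) • x, u)`. -/
def twist : Over S := Over.mk ((glueing T a).toBase ≫ B.hom)

variable (T) in
/-- The projection `π` of the twist to `B`. -/
def twProj : twist T a ⟶ B := Over.homMk (glueing T a).toBase

variable (T) in
/-- The chart `X × U_i ≅ π⁻¹(U_i) ⊆ twist T a`. -/
def chart (i : T.Triv) : X ⊗ i.dom ⟶ twist T a :=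
  Over.homMk ((glueing T a).cover.f i) (by
    have h := (glueing T a).ι_toBase i
    have h2 : (glueing T a).cover.f i ≫ (twist T a).hom =
      ((glueing T a).cover.f i ≫ (glueing T a).toBase) ≫ B.hom := (Category.assoc _ _ _).symm
    have h3 : (glueing T a).cover.f i ≫ (glueing T a).toBase = (snd X i.dom).left ≫ i.U.ι := h
    exact h2.trans ((congrArg (· ≫ B.hom) h3).trans ((Category.assoc _ _ _).trans
      (Over.w (snd X i.dom)))))

lemma chart_proj (i : T.Triv) : chart T a i ≫ twProj T a = snd X i.dom ≫ incl B i.U := by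
  ext1
  exact (glueing T a).ι_toBase i

lemma isPullback_chart (i : T.Triv) :
    IsPullback (chart T a i) (snd X i.dom) (twProj T a) (incl B i.U) := by
  refine IsPullback.of_map (Over.forget S) (chart_proj a i) ?_
  exact ((glueing T a).isPullback_natTrans_ι_toBase i).flip

lemma twMap_chart {i j : T.Triv} (h : i ≤ j) : twMap a h ≫ chart T a j = chart T a i := by
  ext1
  let f : (show T.cover.I₀ from i) ⟶ (show T.cover.I₀ from j) := homOfLE h
  exact map_cover_f (glueing T a) f


lemma chart_cancel {i : T.Triv} {W : Over S} {x x' : W ⟶ X} {u u' : W ⟶ i.dom}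
    (h : lift x u ≫ chart T a i = lift x' u' ≫ chart T a i) : x = x' ∧ u = u' := by
  have hu : u = u' := by
    rw [← cancel_mono (incl B i.U)]
    simpa [chart_proj] using congrArg (· ≫ twProj T a) h
  have := (isPullback_chart a i).hom_ext h (by simpa using hu)
  exact ⟨by simpa using congrArg (· ≫ fst _ _) this, hu⟩

lemma chart_proj_eq {i j : T.Triv} {W : Over S} {x x' : W ⟶ X} {u : W ⟶ i.dom} {u' : W ⟶ j.dom}
    (h : lift x u ≫ chart T a i = lift x' u' ≫ chart T a j) :
    u ≫ incl B i.U = u' ≫ incl B j.U := by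
  simpa [chart_proj] using congrArg (· ≫ twProj T a) h

lemma exists_opn_lift {W B : Over S} (f : W ⟶ B) (U : B.left.Opens)
    (h : ∀ w : W.left, f.left w ∈ U) : ∃ u : W ⟶ opn B U, u ≫ incl B U = f := by
  have hr : Set.range f.left ⊆ Set.range U.ι := by
    rintro _ ⟨w, rfl⟩
    simpa using h w
  refine ⟨Over.homMk (IsOpenImmersion.lift U.ι f.left hr) ?_, ?_⟩
  · have := IsOpenImmersion.lift_fac U.ι f.left hr
    dsimp
    rw [← Category.assoc, this, Over.w]
  · ext1
    exact IsOpenImmersion.lift_fac U.ι f.left hr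

lemma chart_eq_of_smul {i j : T.Triv} {W : Over S} (x : W ⟶ X) (u : W ⟶ i.dom) (u' : W ⟶ j.dom)
    (hu : u ≫ incl B i.U = u' ≫ incl B j.U) (g : W ⟶ G)
    (hg : T.act.smul g (u ≫ i.sec) = u' ≫ j.sec) :
    lift x u ≫ chart T a i = lift (a.smul g x) u' ≫ chart T a j := by
  obtain ⟨w, hw⟩ := exists_opn_lift (u ≫ incl B i.U) (i.U ⊓ j.U) (fun y ↦ ⟨(u.left y).2, by
    rw [hu]; exact (u'.left y).2⟩)
  let k : T.Triv := restr i (i.U ⊓ j.U) inf_le_left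
  have hki : k ≤ i := show i.U ⊓ j.U ≤ i.U from inf_le_left
  have hkj : k ≤ j := show i.U ⊓ j.U ≤ j.U from inf_le_right
  let w' : W ⟶ k.dom := w
  have hwi : w' ≫ inclLE B hki = u := by
    rw [← cancel_mono (incl B i.U), Category.assoc, inclLE_incl]; exact hw
  have hwj : w' ≫ inclLE B hkj = u' := by
    rw [← cancel_mono (incl B j.U), Category.assoc, inclLE_incl, ← hu]; exact hw
  have hks : k.sec = inclLE B hki ≫ i.sec := rfl
  have h1 : trans hki = 1 := by
    symm
    apply eq_div
    rw [T.act.one_smul, hks]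
  have h2 : w' ≫ trans hkj = g := by
    have e1 : T.act.smul (w' ≫ trans hkj) (w' ≫ k.sec) = u' ≫ j.sec := by
      rw [← T.act.comp_smul, trans_smul, ← Category.assoc, hwj]
    have e2 : T.act.smul g (w' ≫ k.sec) = u' ≫ j.sec := by
      rw [hks, ← Category.assoc, hwi, hg]
    refine (T.existsUnique_smul (w' ≫ k.sec) (u' ≫ j.sec) ?_).unique e1 e2
    rw [← e1, T.smul_proj]
  have e3 := congrArg (lift x w' ≫ ·) (twMap_chart a hki)
  have e4 := congrArg (lift x w' ≫ ·) (twMap_chart a hkj)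
  simp only [← Category.assoc, lift_twMap] at e3 e4
  rw [h1, comp_one, a.one_smul, hwi] at e3
  rw [h2, hwj] at e4
  rw [e3, e4]

lemma eq_smul_of_chart_eq {i j : T.Triv} {W : Over S} {x x' : W ⟶ X} {u : W ⟶ i.dom}
    {u' : W ⟶ j.dom} (h : lift x u ≫ chart T a i = lift x' u' ≫ chart T a j) :
    ∃ g : W ⟶ G, T.act.smul g (u ≫ i.sec) = u' ≫ j.sec ∧ x' = a.smul g x := by
  have hu := chart_proj_eq a h
  obtain ⟨g, hg, -⟩ := T.existsUnique_smul (u ≫ i.sec) (u' ≫ j.sec) (by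
    simpa [Triv.sec_proj] using hu)
  refine ⟨g, hg, ?_⟩
  rw [chart_eq_of_smul a x u u' hu g hg] at h
  exact (chart_cancel a h).1.symm

lemma exists_triv {W : Over S} (b : W ⟶ B) (w : W.left) :
    ∃ (O : W.left.Opens) (_ : w ∈ O) (i : T.Triv) (u : opn W O ⟶ i.dom),
      u ≫ incl B i.U = incl W O ≫ b := by
  obtain ⟨U, hU, τ, hτ⟩ := T.exists_section (b.left w)
  obtain ⟨u, hu⟩ := exists_opn_lift (incl W (b.left ⁻¹ᵁ U) ≫ b) U (fun y ↦ y.2)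
  exact ⟨b.left ⁻¹ᵁ U, hU, ⟨U, τ, hτ⟩, u, hu⟩

lemma exists_chart_of_proj {W : Over S} (v : W ⟶ twist T a) (i : T.Triv) (u : W ⟶ i.dom)
    (h : v ≫ twProj T a = u ≫ incl B i.U) : ∃ x : W ⟶ X, v = lift x u ≫ chart T a i := by
  refine ⟨(isPullback_chart a i).lift v u h ≫ fst _ _, ?_⟩
  conv_lhs => rw [← (isPullback_chart a i).lift_fst v u h]
  congr 1
  ext1 <;> simp

lemma exists_chart {W : Over S} (v : W ⟶ twist T a) (w : W.left) :
    ∃ (O : W.left.Opens) (_ : w ∈ O) (i : T.Triv) (x : opn W O ⟶ X) (u : opn W O ⟶ i.dom),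
      incl W O ≫ v = lift x u ≫ chart T a i := by
  obtain ⟨O, hO, i, u, hu⟩ := exists_triv (T := T) (v ≫ twProj T a) w
  obtain ⟨x, hx⟩ := exists_chart_of_proj a (incl W O ≫ v) i u (by simpa using hu.symm)
  exact ⟨O, hO, i, x, u, hx⟩

lemma hom_ext_local {W Y : Over S} (f g : W ⟶ Y)
    (h : ∀ w : W.left, ∃ O : W.left.Opens, w ∈ O ∧ incl W O ≫ f = incl W O ≫ g) : f = g := by
  ext1
  refine Scheme.hom_ext_of_forall _ _ fun w ↦ ?_
  obtain ⟨O, hO, e⟩ := h w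
  exact ⟨O, hO, congrArg (fun φ ↦ φ.left) e⟩

/-- Gluing of morphisms that are unique locally. -/
lemma exists_glue {W Y : Over S} (P : ∀ {W' : Over S}, (W' ⟶ W) → (W' ⟶ Y) → Prop)
    (stable : ∀ {W' W'' : Over S} (h : W'' ⟶ W') (f : W' ⟶ W) (y : W' ⟶ Y),
      P f y → P (h ≫ f) (h ≫ y))
    (unique : ∀ {W' : Over S} (f : W' ⟶ W) (y y' : W' ⟶ Y), P f y → P f y' → y = y')
    (locally : ∀ w : W.left, ∃ O : W.left.Opens, w ∈ O ∧ ∃ y, P (incl W O) y) :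
    ∃ y : W ⟶ Y, ∀ {W' : Over S} (f : W' ⟶ W) (y' : W' ⟶ Y), P f y' → f ≫ y = y' := by
  choose O hO y hy using locally
  let 𝒰 : W.left.OpenCover := {
    I₀ := W.left, X w := (O w), f w := (O w).ι,
    mem₀ := by
      rw [Scheme.presieve₀_mem_precoverage_iff]
      refine ⟨fun x ↦ ⟨x, by simpa using hO x⟩, inferInstance⟩ }
  have compat : ∀ w w' : W.left,
      pullback.fst (O w).ι (O w').ι ≫ (y w).left = pullback.snd (O w).ι (O w').ι ≫ (y w').left := by
    intro w w'
    let Q : Over S := Over.mk (pullback.fst (O w).ι (O w').ι ≫ (O w).ι ≫ W.hom)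
    let p : Q ⟶ opn W (O w) := Over.homMk (pullback.fst (O w).ι (O w').ι) rfl
    let q : Q ⟶ opn W (O w') := Over.homMk (pullback.snd (O w).ι (O w').ι) (by
      dsimp [Q]; rw [pullback.condition_assoc])
    have hpq : p ≫ incl W (O w) = q ≫ incl W (O w') := by
      ext1; exact pullback.condition
    have := unique (p ≫ incl W (O w)) (p ≫ y w) (q ≫ y w') (stable _ _ _ (hy w)) (by
      rw [hpq]; exact stable _ _ _ (hy w'))
    exact congrArg (fun φ ↦ φ.left) this
  let z : W.left ⟶ Y.left := Scheme.Cover.glueMorphisms 𝒰 (fun w ↦ (y w).left) compat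
  have hz : ∀ w, (O w).ι ≫ z = (y w).left := fun w ↦
    Scheme.Cover.ι_glueMorphisms 𝒰 (fun w ↦ (y w).left) compat w
  have hzw : z ≫ Y.hom = W.hom := by
    refine Scheme.hom_ext_of_forall _ _ fun w ↦ ⟨O w, hO w, ?_⟩
    rw [← Category.assoc, hz, Over.w (y w)]; rfl
  let Z : W ⟶ Y := Over.homMk z hzw
  have hZ : ∀ w, incl W (O w) ≫ Z = y w := fun w ↦ by ext1; exact hz w
  refine ⟨Z, fun {W'} f y' h ↦ hom_ext_local _ _ fun w' ↦ ?_⟩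
  let w := f.left w'
  refine ⟨f.left ⁻¹ᵁ O w, hO w, ?_⟩
  obtain ⟨u, hu⟩ := exists_opn_lift (incl W' (f.left ⁻¹ᵁ O w) ≫ f) (O w) (fun y ↦ y.2)
  rw [← Category.assoc, ← hu, Category.assoc, hZ]
  refine unique (u ≫ incl W (O w)) _ _ (stable _ _ _ (hy w)) ?_
  rw [hu]
  exact stable _ _ _ h

/-- Transformations of local coordinates that commute with `G` glue. -/
lemma exists_twist_hom {X' : Over S} (a' : GAction G X') {W : Over S} (v : W ⟶ twist T a)
    (Φ : ∀ {W' : Over S}, (W' ⟶ W) → (W' ⟶ X) → (W' ⟶ X'))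
    (hΦ : ∀ {W' W'' : Over S} (h : W'' ⟶ W') (f : W' ⟶ W) (x : W' ⟶ X),
      h ≫ Φ f x = Φ (h ≫ f) (h ≫ x))
    (hΦg : ∀ {W' : Over S} (f : W' ⟶ W) (g : W' ⟶ G) (x : W' ⟶ X),
      Φ f (a.smul g x) = a'.smul g (Φ f x)) :
    ∃ y : W ⟶ twist T a', ∀ {W' : Over S} (f : W' ⟶ W) (i : T.Triv) (x : W' ⟶ X)
      (u : W' ⟶ i.dom), f ≫ v = lift x u ≫ chart T a i → f ≫ y = lift (Φ f x) u ≫ chart T a' i := by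
  obtain ⟨y, hy⟩ := exists_glue (W := W) (Y := twist T a')
    (fun {W'} f y ↦ ∃ (i : T.Triv) (x : W' ⟶ X) (u : W' ⟶ i.dom),
      f ≫ v = lift x u ≫ chart T a i ∧ y = lift (Φ f x) u ≫ chart T a' i)
    (by
      rintro W' W'' h f y ⟨i, x, u, h1, rfl⟩
      refine ⟨i, h ≫ x, h ≫ u, ?_, ?_⟩
      · rw [Category.assoc, h1, ← Category.assoc, comp_lift]
      · rw [← Category.assoc, comp_lift, hΦ])
    (by
      rintro W' f _ _ ⟨i, x, u, h1, rfl⟩ ⟨j, x', u', h2, rfl⟩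
      rw [h1] at h2
      obtain ⟨g, hg, rfl⟩ := eq_smul_of_chart_eq a h2
      rw [hΦg]
      exact chart_eq_of_smul a' _ _ _ (chart_proj_eq a h2) g hg)
    (fun w ↦ by
      obtain ⟨O, hO, i, x, u, h⟩ := exists_chart a v w
      exact ⟨O, hO, _, i, x, u, h, rfl⟩)
  exact ⟨y, fun f i x u h ↦ hy f _ ⟨i, x, u, h, rfl⟩⟩

end GTorsor

/-- An `S`-scheme with a scaling by functions, that is, with an action of the multiplicative monoid
of the affine line, given functorially on points. -/
structure Scaled (S : Scheme.{0}) where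
  total : Over S
  scale : ∀ {W : Over S}, Fn W → (W ⟶ total) → (W ⟶ total)
  comp_scale : ∀ {W W' : Over S} (f : W' ⟶ W) (c : Fn W) (v : W ⟶ total),
    f ≫ scale c v = scale (res f c) (f ≫ v)
  one_scale : ∀ {W : Over S} (v : W ⟶ total), scale 1 v = v
  mul_scale : ∀ {W : Over S} (c d : Fn W) (v : W ⟶ total), scale (c * d) v = scale c (scale d v)

/-- A scheme with a scaling and a `G`-action that commutes with the scaling. -/
structure GScaled (G : Over S) [GrpObj G] extends Scaled S where
  act : GAction G total
  smul_scale : ∀ {W : Over S} (g : W ⟶ G) (c : Fn W) (v : W ⟶ total),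
    act.smul g (scale c v) = scale c (act.smul g v)

/-- A (geometric) line bundle over `Y`: a `Y`-scheme with fibrewise scaling by functions which is,
locally on `Y`, isomorphic to the affine line with its scaling: there is a section `s` over `V` such
that every point above `V` is `c • s` for a unique function `c`. (The transition functions between
two such trivializations are invertible functions, so the scaling determines the linear
structure of the fibres.) -/
structure LineBundle (Y : Over S) extends Scaled S where
  proj : total ⟶ Y
  scale_proj : ∀ {W : Over S} (c : Fn W) (v : W ⟶ total), scale c v ≫ proj = v ≫ proj
  locally_trivial : ∀ y : Y.left, ∃ (V : Over S) (j : V ⟶ Y) (s : V ⟶ total),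
    IsOpenImmersion j.left ∧ y ∈ Set.range j.left ∧ s ≫ proj = j ∧
    ∀ {W : Over S} (u : W ⟶ V) (v : W ⟶ total), v ≫ proj = u ≫ j →
      ∃! c : Fn W, scale c (u ≫ s) = v

/-- A `G`-linearized line bundle over the `G`-scheme `X`: a line bundle whose total space has an
action of `G`, linear on fibres, lifting the action on `X`. -/
structure GLineBundle {X : Over S} (a : GAction G X) extends LineBundle X where
  act : GAction G total
  smul_scale : ∀ {W : Over S} (g : W ⟶ G) (c : Fn W) (v : W ⟶ total),
    act.smul g (scale c v) = scale c (act.smul g v)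
  smul_proj : ∀ {W : Over S} (g : W ⟶ G) (v : W ⟶ total),
    act.smul g v ≫ proj = a.smul g (v ≫ proj)

/-- The total space of a `G`-linearized line bundle. -/
abbrev GLineBundle.toGScaled {X : Over S} {a : GAction G X} (L : GLineBundle a) : GScaled G where
  toScaled := L.toScaled
  act := L.act
  smul_scale := L.smul_scale

namespace GTorsor
variable (T : GTorsor G B)

lemma exists_twScale (L : GScaled G) {W : Over S} (c : Fn W) (v : W ⟶ twist T L.act) :
    ∃ y : W ⟶ twist T L.act, ∀ {W' : Over S} (f : W' ⟶ W) (i : T.Triv) (x : W' ⟶ L.total)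
      (u : W' ⟶ i.dom), f ≫ v = lift x u ≫ chart T L.act i →
        f ≫ y = lift (L.scale (res f c) x) u ≫ chart T L.act i :=
  exists_twist_hom L.act L.act v (fun f x ↦ L.scale (res f c) x)
    (fun h f x ↦ by rw [L.comp_scale, res_comp]) (fun f g x ↦ (L.smul_scale g _ x).symm)

/-- The scaling on the twist of a scheme with scaling: in each chart it is
`c • [x, u] = [c • x, u]`. -/
def twScale (L : GScaled G) {W : Over S} (c : Fn W) (v : W ⟶ twist T L.act) : W ⟶ twist T L.act :=
  (exists_twScale T L c v).choose

lemma comp_twScale (L : GScaled G) {W W' : Over S} (c : Fn W) (v : W ⟶ twist T L.act)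
    (f : W' ⟶ W) (i : T.Triv) (x : W' ⟶ L.total) (u : W' ⟶ i.dom)
    (h : f ≫ v = lift x u ≫ chart T L.act i) :
    f ≫ twScale T L c v = lift (L.scale (res f c) x) u ≫ chart T L.act i :=
  (exists_twScale T L c v).choose_spec f i x u h

lemma twScale_chart (L : GScaled G) {W : Over S} (c : Fn W) (i : T.Triv) (x : W ⟶ L.total)
    (u : W ⟶ i.dom) : twScale T L c (lift x u ≫ chart T L.act i) =
      lift (L.scale c x) u ≫ chart T L.act i := by
  have := comp_twScale T L c (lift x u ≫ chart T L.act i) (𝟙 W) i x u (Category.id_comp _)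
  rwa [Category.id_comp, res_id] at this

lemma twScale_proj (L : GScaled G) {W : Over S} (c : Fn W) (v : W ⟶ twist T L.act) :
    twScale T L c v ≫ twProj T L.act = v ≫ twProj T L.act := hom_ext_local _ _ fun w ↦ by
  obtain ⟨O, hO, i, x, u, h⟩ := exists_chart L.act v w
  refine ⟨O, hO, ?_⟩
  rw [← Category.assoc, ← Category.assoc, comp_twScale T L c v _ i x u h, h]
  simp [chart_proj]

/-- The twist of a `G`-scheme with scaling, as a scheme with scaling. -/
abbrev twScaled (L : GScaled G) : Scaled S where
  total := twist T L.act
  scale := twScale T L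
  comp_scale f c v := hom_ext_local _ _ fun w ↦ by
    obtain ⟨O, hO, i, x, u, h⟩ := exists_chart L.act (f ≫ v) w
    refine ⟨O, hO, ?_⟩
    rw [comp_twScale T L (res f c) (f ≫ v) _ i x u h, ← Category.assoc,
      comp_twScale T L c v _ i x u (by rw [Category.assoc, h]), res_comp]
  one_scale v := hom_ext_local _ _ fun w ↦ by
    obtain ⟨O, hO, i, x, u, h⟩ := exists_chart L.act v w
    refine ⟨O, hO, ?_⟩
    rw [comp_twScale T L _ v _ i x u h, map_one, L.one_scale, h]
  mul_scale c d v := hom_ext_local _ _ fun w ↦ by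
    obtain ⟨O, hO, i, x, u, h⟩ := exists_chart L.act v w
    refine ⟨O, hO, ?_⟩
    rw [comp_twScale T L _ v _ i x u h,
      comp_twScale T L _ _ _ i _ u (comp_twScale T L _ v _ i x u h), map_mul, L.mul_scale]

lemma exists_twHom {X X' : Over S} (a : GAction G X) (a' : GAction G X') (φ : X ⟶ X')
    (hφ : ∀ {W : Over S} (g : W ⟶ G) (x : W ⟶ X), a.smul g x ≫ φ = a'.smul g (x ≫ φ)) :
    ∃ y : twist T a ⟶ twist T a', ∀ {W : Over S} (f : W ⟶ twist T a) (i : T.Triv) (x : W ⟶ X)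
      (u : W ⟶ i.dom), f ≫ 𝟙 _ = lift x u ≫ chart T a i → f ≫ y = lift (x ≫ φ) u ≫ chart T a' i :=
  exists_twist_hom a a' (𝟙 _) (fun _ x ↦ x ≫ φ) (fun h f x ↦ by simp) (fun f g x ↦ hφ g x)

/-- The morphism of twists induced by a `G`-equivariant morphism `φ`: `[x, u] ↦ [φ x, u]`. -/
def twHom {X X' : Over S} (a : GAction G X) (a' : GAction G X') (φ : X ⟶ X')
    (hφ : ∀ {W : Over S} (g : W ⟶ G) (x : W ⟶ X), a.smul g x ≫ φ = a'.smul g (x ≫ φ)) :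
    twist T a ⟶ twist T a' := (exists_twHom T a a' φ hφ).choose

lemma chart_twHom {X X' : Over S} (a : GAction G X) (a' : GAction G X') (φ : X ⟶ X')
    (hφ : ∀ {W : Over S} (g : W ⟶ G) (x : W ⟶ X), a.smul g x ≫ φ = a'.smul g (x ≫ φ))
    {W : Over S} (i : T.Triv) (x : W ⟶ X) (u : W ⟶ i.dom) :
    (lift x u ≫ chart T a i) ≫ twHom T a a' φ hφ = lift (x ≫ φ) u ≫ chart T a' i :=
  (exists_twHom T a a' φ hφ).choose_spec _ i x u (Category.comp_id _)

lemma twHom_proj {X X' : Over S} (a : GAction G X) (a' : GAction G X') (φ : X ⟶ X')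
    (hφ : ∀ {W : Over S} (g : W ⟶ G) (x : W ⟶ X), a.smul g x ≫ φ = a'.smul g (x ≫ φ)) :
    twHom T a a' φ hφ ≫ twProj T a' = twProj T a := hom_ext_local _ _ fun w ↦ by
  obtain ⟨O, hO, i, x, u, h⟩ := exists_chart a (𝟙 (twist T a)) w
  refine ⟨O, hO, ?_⟩
  rw [Category.comp_id] at h
  rw [h, ← Category.assoc, chart_twHom]
  simp [chart_proj]

lemma isPullback_lift_fst {V X D : Over S} (j : V ⟶ X) :
    IsPullback (lift (fst V D ≫ j) (snd V D)) (fst V D) (fst X D) j := by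
  refine ⟨⟨by simp⟩, ⟨PullbackCone.IsLimit.mk _
    (fun s ↦ lift s.snd (s.fst ≫ snd _ _)) (fun s ↦ ?_) (fun s ↦ by simp) (fun s m h₁ h₂ ↦ ?_)⟩⟩
  · rw [comp_lift]
    ext1 <;> simp [s.condition]
  · ext1
    · simpa using h₂
    · simpa using congrArg (· ≫ snd _ _) h₁

lemma isOpenImmersion_chart {X : Over S} (a : GAction G X) (i : T.Triv) :
    IsOpenImmersion (chart T a i).left :=
  MorphismProperty.of_isPullback (P := @IsOpenImmersion)
    ((isPullback_chart (T := T) a i).map (Over.forget S)).flip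
    (inferInstanceAs (IsOpenImmersion i.U.ι))

lemma isOpenImmersion_lift_chart {X V : Over S} (a : GAction G X) (i : T.Triv) (j : V ⟶ X)
    (hj : IsOpenImmersion j.left) :
    IsOpenImmersion (lift (fst V i.dom ≫ j) (snd V i.dom) ≫ chart T a i).left := by
  have h1 := isOpenImmersion_chart T a i
  have h2 : IsOpenImmersion (lift (fst V i.dom ≫ j) (snd V i.dom)).left :=
    MorphismProperty.of_isPullback (P := @IsOpenImmersion)
      ((isPullback_lift_fst (D := i.dom) j).map (Over.forget S)).flip hj
  rw [Over.comp_left]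
  infer_instance

lemma mem_range_lift_chart {X V W : Over S} (a : GAction G X) (i : T.Triv) (j : V ⟶ X)
    (x : W ⟶ X) (u : W ⟶ i.dom) (w : W.left) (hw : x.left w ∈ Set.range j.left) :
    (lift x u ≫ chart T a i).left w ∈
      Set.range (lift (fst V i.dom ≫ j) (snd V i.dom) ≫ chart T a i).left := by
  obtain ⟨v, hv⟩ := hw
  have hz : (fst X i.dom).left ((lift x u).left w) = j.left v := by
    rw [hv, ← Scheme.Hom.comp_apply, ← Over.comp_left, lift_fst]
  obtain ⟨z, hz1, hz2⟩ := Scheme.exists_preimage_of_isPullback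
    ((isPullback_lift_fst (D := i.dom) j).map (Over.forget S)) _ _ hz
  refine ⟨z, ?_⟩
  have e : (lift x u ≫ chart T a i).left w = (chart T a i).left ((lift x u).left w) := rfl
  rw [e]
  exact congrArg (chart T a i).left hz1

/-- The line bundle `ϑ(L)` on the twist of `X` associated with a `G`-linearized line bundle `L` on
`X`: its total space is glued from the pieces `L × U_i` along the maps given by the transition
functions `g_ji` of `T` and the linearization. -/
def theta {X : Over S} {a : GAction G X} (L : GLineBundle a) : LineBundle (twist T a) where
  toScaled := twScaled T L.toGScaled
  proj := twHom T L.act a L.proj L.smul_proj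
  scale_proj c v := hom_ext_local _ _ fun w ↦ by
    obtain ⟨O, hO, i, x, u, h⟩ := exists_chart L.act v w
    refine ⟨O, hO, ?_⟩
    rw [← Category.assoc, ← Category.assoc, h, comp_twScale T L.toGScaled c v _ i x u h,
      chart_twHom, chart_twHom, L.scale_proj]
  locally_trivial y := by
    obtain ⟨O, hO, i, x, u, h⟩ := exists_chart a (𝟙 (twist T a)) y
    rw [Category.comp_id] at h
    obtain ⟨V, j, s, hj, hy, hs, huniq⟩ := L.locally_trivial (x.left ⟨y, hO⟩)
    refine ⟨V ⊗ i.dom, lift (fst _ _ ≫ j) (snd _ _) ≫ chart T a i,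
      lift (fst _ _ ≫ s) (snd _ _) ≫ chart T L.act i, isOpenImmersion_lift_chart T a i j hj,
      ?_, ?_, ?_⟩
    · have := mem_range_lift_chart T a i j x u ⟨y, hO⟩ hy
      rw [← h] at this
      exact this
    · rw [chart_twHom, Category.assoc, hs]
    · intro W w v hv
      have hv' : v ≫ twProj T L.act = (w ≫ snd _ _) ≫ incl B i.U := by
        rw [← twHom_proj T L.act a L.proj L.smul_proj, ← Category.assoc, hv]
        simp [chart_proj]
      obtain ⟨x', rfl⟩ := exists_chart_of_proj L.act v i _ hv'
      rw [chart_twHom, ← Category.assoc, comp_lift] at hv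
      have hx := (chart_cancel a hv).1
      obtain ⟨c, hc, hc'⟩ := huniq (w ≫ fst _ _) x' (by simpa using hx)
      have key : ∀ d : Fn W, twScale T L.toGScaled d
          (w ≫ lift (fst V i.dom ≫ s) (snd V i.dom) ≫ chart T L.act i) =
          lift (L.scale d ((w ≫ fst _ _) ≫ s)) (w ≫ snd _ _) ≫ chart T L.act i := fun d ↦ by
        rw [← Category.assoc, comp_lift, twScale_chart, Category.assoc]
      refine ⟨c, ?_, fun d hd ↦ hc' d ?_⟩
      · exact (key c).trans (by rw [hc])
      · exact (chart_cancel L.act ((key d).symm.trans hd)).1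


end GTorsor

/-- The affine line over `S`. -/
abbrev A1 (S : Scheme.{0}) : Over S := Over.mk (𝔸(PUnit; S) ↘ S)

/-- The coordinate of a point of the affine line. -/
def coord {W : Over S} (x : W ⟶ A1 S) : Fn W :=
  x.left.appTop.hom (AffineSpace.coord S PUnit.unit)

/-- The point of the affine line with given coordinate. -/
def ofCoord {W : Over S} (c : Fn W) : W ⟶ A1 S :=
  Over.homMk (AffineSpace.homOfVector W.hom fun _ ↦ c) (AffineSpace.homOfVector_over _ _)

lemma coord_ofCoord {W : Over S} (c : Fn W) : coord (ofCoord c) = c :=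
  AffineSpace.homOfVector_appTop_coord _ _ _

lemma ofCoord_coord {W : Over S} (x : W ⟶ A1 S) : ofCoord (coord x) = x := by
  ext1
  refine AffineSpace.hom_ext ?_ fun _ ↦ ?_
  · exact (AffineSpace.homOfVector_over _ _).trans (Over.w x).symm
  · exact AffineSpace.homOfVector_appTop_coord _ _ _

lemma coord_comp {W W' : Over S} (f : W' ⟶ W) (x : W ⟶ A1 S) :
    coord (f ≫ x) = res f (coord x) := by
  change (f ≫ x).left.appTop.hom _ = _
  rw [Over.comp_left, Scheme.Hom.comp_appTop]; rfl

lemma comp_ofCoord {W W' : Over S} (f : W' ⟶ W) (c : Fn W) :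
    f ≫ ofCoord c = ofCoord (res f c) := by
  rw [← ofCoord_coord (f ≫ ofCoord c), coord_comp, coord_ofCoord]

/-- A character of `G`: a homomorphism of `S`-group schemes from `G` to the multiplicative group,
whose points with values in `W` are the invertible functions on `W`. -/
structure Character (G : Over S) [GrpObj G] where
  val : ∀ {W : Over S}, (W ⟶ G) →* (Fn W)ˣ
  val_comp : ∀ {W W' : Over S} (f : W' ⟶ W) (g : W ⟶ G),
    (val (f ≫ g) : Fn W') = res f (val g)

namespace Character
variable (χ : Character G)

/-- The action of `G` on the affine line through `χ`. -/
abbrev actA1 : GAction G (A1 S) where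
  smul g x := ofCoord (χ.val g * coord x)
  comp_smul f g x := by rw [comp_ofCoord, map_mul, ← χ.val_comp, coord_comp]
  one_smul x := by simp [ofCoord_coord]
  mul_smul g h x := by simp [coord_ofCoord, _root_.mul_assoc]

/-- The one-dimensional representation of `G` (line bundle on `S` with `G`-action) given by `χ`. -/
abbrev rep : GScaled G where
  total := A1 S
  scale c x := ofCoord (c * coord x)
  comp_scale f c x := by rw [comp_ofCoord, map_mul, coord_comp]
  one_scale x := by rw [_root_.one_mul, ofCoord_coord]
  mul_scale c d x := by rw [coord_ofCoord, _root_.mul_assoc]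
  act := χ.actA1
  smul_scale g c x := by
    simp only [actA1, coord_ofCoord]
    rw [mul_left_comm]

variable {X : Over S} (a : GAction G X)

/-- The action `g • (t, x) = (χ(g) t, g • x)` on `𝔸¹ × X`. -/
def actProd : GAction G (A1 S ⊗ X) where
  smul g v := lift (χ.actA1.smul g (v ≫ fst _ _)) (a.smul g (v ≫ snd _ _))
  comp_smul f g v := by rw [comp_lift, χ.actA1.comp_smul, a.comp_smul]; simp
  one_smul v := by rw [χ.actA1.one_smul, a.one_smul]; ext1 <;> simp
  mul_smul g h v := by rw [χ.actA1.mul_smul, a.mul_smul]; simp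

/-- `ι(χ)`: the trivial line bundle `𝔸¹ × X` on `X`, linearized by `χ` on the factor `𝔸¹`. -/
def iota : GLineBundle a where
  total := A1 S ⊗ X
  scale c v := lift (ofCoord (c * coord (v ≫ fst _ _))) (v ≫ snd _ _)
  comp_scale f c v := by
    rw [comp_lift, comp_ofCoord, map_mul, ← coord_comp]; simp
  one_scale v := by rw [_root_.one_mul, ofCoord_coord]; ext1 <;> simp
  mul_scale c d v := by simp [coord_ofCoord, _root_.mul_assoc]
  proj := snd _ _
  scale_proj c v := by simp
  locally_trivial y := by
    refine ⟨X, 𝟙 X, lift (ofCoord 1) (𝟙 X), inferInstanceAs (IsOpenImmersion (𝟙 _)), ⟨y, rfl⟩,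
      by simp, fun {W} u v h ↦ ?_⟩
    have e : ∀ c : Fn W, lift (ofCoord (c * coord ((u ≫ lift (ofCoord 1) (𝟙 X)) ≫ fst _ _)))
        ((u ≫ lift (ofCoord 1) (𝟙 X)) ≫ snd _ _) = lift (ofCoord c) u := fun c ↦ by
      simp [comp_ofCoord, coord_ofCoord]
    simp only [e]
    refine ⟨coord (v ≫ fst _ _), ?_, fun c hc ↦ ?_⟩
    · dsimp only
      rw [ofCoord_coord]
      ext1
      · simp
      · simpa using h.symm
    · rw [← hc, lift_fst, coord_ofCoord]
  act := χ.actProd a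
  smul_scale g c v := by
    simp [actProd, actA1, coord_ofCoord, mul_left_comm]
  smul_proj g v := by simp [actProd]

variable (T : GTorsor G B)

lemma section_proj (i : T.Triv) :
    (lift (ofCoord 1) (𝟙 i.dom) ≫ T.chart χ.actA1 i) ≫ T.twProj χ.actA1 = incl B i.U := by
  rw [Category.assoc, GTorsor.chart_proj, ← Category.assoc, lift_snd, Category.id_comp]

lemma scale_section {W : Over S} (i : T.Triv) (u : W ⟶ i.dom) (c : Fn W) :
    T.twScale χ.rep c (u ≫ lift (ofCoord 1) (𝟙 i.dom) ≫ T.chart χ.actA1 i) =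
      lift (ofCoord c) u ≫ T.chart χ.actA1 i := by
  have e : u ≫ lift (ofCoord 1) (𝟙 i.dom) ≫ T.chart χ.actA1 i =
      lift (ofCoord 1) u ≫ T.chart χ.actA1 i := by
    rw [← Category.assoc, comp_lift, comp_ofCoord, map_one, Category.comp_id]
  refine (congrArg _ e).trans ((T.twScale_chart χ.rep c i (ofCoord 1) u).trans ?_)
  change lift (ofCoord (c * coord (ofCoord 1))) u ≫ T.chart χ.actA1 i = _
  rw [coord_ofCoord, _root_.mul_one]

lemma existsUnique_scale_section {W : Over S} (i : T.Triv) (u : W ⟶ i.dom)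
    (v : W ⟶ T.twist χ.actA1) (h : v ≫ T.twProj χ.actA1 = u ≫ incl B i.U) :
    ∃! c : Fn W, T.twScale χ.rep c (u ≫ lift (ofCoord 1) (𝟙 i.dom) ≫ T.chart χ.actA1 i) = v := by
  obtain ⟨x, rfl⟩ := GTorsor.exists_chart_of_proj χ.actA1 v i u h
  refine ⟨coord x, (χ.scale_section T i u _).trans (by rw [ofCoord_coord]), fun d hd ↦ ?_⟩
  have := (GTorsor.chart_cancel χ.actA1 ((χ.scale_section T i u d).symm.trans hd)).1
  rw [← this, coord_ofCoord]

/-- `η_T(χ)`: the line bundle on `B` glued from the pieces `𝔸¹ × U_i` along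
`(t, u) ↦ (χ(g_ji(u)) t, u)`, that is, the twist by `T` of the representation given by `χ`. -/
def eta : LineBundle B where
  toScaled := T.twScaled χ.rep
  proj := T.twProj χ.actA1
  scale_proj c v := T.twScale_proj χ.rep c v
  locally_trivial y := by
    obtain ⟨U, hU, τ, hτ⟩ := T.exists_section y
    exact ⟨opn B U, incl B U, lift (ofCoord 1) (𝟙 _) ≫ T.chart χ.actA1 ⟨U, τ, hτ⟩,
      inferInstanceAs (IsOpenImmersion U.ι), ⟨⟨y, hU⟩, rfl⟩, χ.section_proj T ⟨U, τ, hτ⟩,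
      fun u v h ↦ χ.existsUnique_scale_section T ⟨U, τ, hτ⟩ u v h⟩

end Character

namespace LineBundle
variable {Y Y' : Over S} (L : LineBundle Y) (p : Y' ⟶ Y)

/-- Scaling on the pulled back bundle. -/
def pbScale {W : Over S} (c : Fn W) (v : W ⟶ pullback L.proj p) : W ⟶ pullback L.proj p :=
  pullback.lift (L.scale c (v ≫ pullback.fst _ _)) (v ≫ pullback.snd _ _) (by
    rw [L.scale_proj, Category.assoc, Category.assoc, pullback.condition])

@[simp]
lemma pbScale_fst {W : Over S} (c : Fn W) (v : W ⟶ pullback L.proj p) :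
    pbScale L p c v ≫ pullback.fst _ _ = L.scale c (v ≫ pullback.fst _ _) :=
  pullback.lift_fst _ _ _

@[simp]
lemma pbScale_snd {W : Over S} (c : Fn W) (v : W ⟶ pullback L.proj p) :
    pbScale L p c v ≫ pullback.snd _ _ = v ≫ pullback.snd _ _ :=
  pullback.lift_snd _ _ _

/-- The pull-back of a line bundle along `p`. -/
def pull : LineBundle Y' where
  total := pullback L.proj p
  scale c v := pbScale L p c v
  comp_scale f c v := by
    apply pullback.hom_ext <;> simp [L.comp_scale]
  one_scale v := by
    apply pullback.hom_ext <;> simp [L.one_scale]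
  mul_scale c d v := by
    apply pullback.hom_ext <;> simp [L.mul_scale]
  proj := pullback.snd _ _
  scale_proj c v := by simp
  locally_trivial y := by
    obtain ⟨V, j, s, hj, ⟨z, hz⟩, hs, huniq⟩ := L.locally_trivial (p.left y)
    have e : (pullback.fst j p ≫ s) ≫ L.proj = pullback.snd j p ≫ p := by
      rw [Category.assoc, hs, pullback.condition]
    refine ⟨pullback j p, pullback.snd _ _, pullback.lift (pullback.fst _ _ ≫ s)
      (pullback.snd _ _) e, ?_, ?_, pullback.lift_snd _ _ _, ?_⟩
    · exact MorphismProperty.of_isPullback (P := @IsOpenImmersion)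
        ((IsPullback.of_hasPullback j p).map (Over.forget S)) hj
    · obtain ⟨w, hw1, hw2⟩ := Scheme.exists_preimage_of_isPullback
        ((IsPullback.of_hasPullback j p).map (Over.forget S)) z y hz
      exact ⟨w, hw2⟩
    · intro W u v h
      obtain ⟨c, hc, hc'⟩ := huniq (u ≫ pullback.fst _ _) (v ≫ pullback.fst _ _) (by
        rw [Category.assoc, Category.assoc, pullback.condition, pullback.condition,
          ← Category.assoc, h, Category.assoc])
      have e1 : (u ≫ pullback.lift (pullback.fst _ _ ≫ s) (pullback.snd _ _) e) ≫
          pullback.fst _ _ = (u ≫ pullback.fst _ _) ≫ s := by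
        rw [Category.assoc, pullback.lift_fst, Category.assoc]
      have e2 : (u ≫ pullback.lift (pullback.fst _ _ ≫ s) (pullback.snd _ _) e) ≫
          pullback.snd _ _ = u ≫ pullback.snd _ _ := by
        rw [Category.assoc, pullback.lift_snd]
      refine ⟨c, ?_, fun d hd ↦ hc' d ?_⟩
      · apply pullback.hom_ext
        · rw [pbScale_fst, e1]; exact hc
        · rw [pbScale_snd, e2]; exact h.symm
      · exact (congrArg (L.scale d) e1.symm).trans
          ((pbScale_fst L p d _).symm.trans (congrArg (· ≫ pullback.fst _ _) hd))

end LineBundle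

/-- `Spec ℂ`, as an `S`-scheme via the complex point `s` of `S`. -/
abbrev pt (s : Spec (.of ℂ) ⟶ S) : Over S := Over.mk s

/-- The value in `ℂ` of a function on `Spec ℂ`. -/
def ev (s : Spec (.of ℂ) ⟶ S) : Fn (pt s) →+* ℂ := (Scheme.ΓSpecIso (.of ℂ)).hom.hom

lemma ev_injective (s : Spec (.of ℂ) ⟶ S) : Function.Injective (ev s) := by
  intro x y h
  have h' : (Scheme.ΓSpecIso (.of ℂ)).inv.hom (ev s x) = (Scheme.ΓSpecIso (.of ℂ)).inv.hom (ev s y) :=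
    congrArg _ h
  simpa [ev] using h'

/-- The complex topology on the set of complex points of `X` above `s`: the coarsest one for which
the sets `U(ℂ)` with `U` open in `X` are open and all functions `f` on `U` define continuous maps
`U(ℂ) → ℂ`. -/
instance complexTopology (s : Spec (.of ℂ) ⟶ S) (X : Over S) : TopologicalSpace (pt s ⟶ X) :=
  TopologicalSpace.generateFrom {A | ∃ (U : X.left.Opens) (f : Fn (opn X U)) (O : Set ℂ),
    IsOpen O ∧ A = {x | ∃ y : pt s ⟶ opn X U, y ≫ incl X U = x ∧ ev s (res y f) ∈ O}}

/-- `K` is a maximal compact subgroup of the group of complex points of `G` above `s`. -/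
structure IsMaximalCompact {s : Spec (.of ℂ) ⟶ S} (K : Subgroup (pt s ⟶ G)) : Prop where
  isCompact : IsCompact (K : Set (pt s ⟶ G))
  maximal : ∀ K' : Subgroup (pt s ⟶ G), IsCompact (K' : Set (pt s ⟶ G)) → K ≤ K' → K' = K

lemma Character.continuous_ev (χ : Character G) (s : Spec (.of ℂ) ⟶ S) :
    Continuous fun g : pt s ⟶ G ↦ ev s (χ.val g : Fn (pt s)) := by
  refine continuous_def.2 fun O hO ↦ ?_
  apply TopologicalSpace.isOpen_generateFrom_of_mem
  refine ⟨⊤, (χ.val (incl G ⊤) : Fn (opn G ⊤)), O, hO, ?_⟩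
  ext g
  constructor
  · intro hg
    obtain ⟨y, hy⟩ := GTorsor.exists_opn_lift g ⊤ (fun _ ↦ trivial)
    refine ⟨y, hy, ?_⟩
    rw [← χ.val_comp, hy]
    exact hg
  · rintro ⟨y, rfl, hy⟩
    rw [← χ.val_comp] at hy
    exact hy

lemma Character.norm_ev_le_one (χ : Character G) {s : Spec (.of ℂ) ⟶ S}
    {K : Subgroup (pt s ⟶ G)} (hK : IsCompact (K : Set (pt s ⟶ G))) {k : pt s ⟶ G} (hk : k ∈ K) :
    ‖ev s (χ.val k : Fn (pt s))‖ ≤ 1 := by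
  obtain ⟨C, hC⟩ := (hK.image (χ.continuous_ev s)).isBounded.exists_norm_le
  by_contra! h
  obtain ⟨n, hn⟩ := pow_unbounded_of_one_lt C h
  have : ‖ev s (χ.val (k ^ n) : Fn (pt s))‖ ≤ C := hC _ ⟨k ^ n, K.pow_mem hk n, rfl⟩
  rw [map_pow, Units.val_pow_eq_pow_val, map_pow, norm_pow] at this
  linarith

lemma Character.norm_ev_eq_one (χ : Character G) {s : Spec (.of ℂ) ⟶ S}
    {K : Subgroup (pt s ⟶ G)} (hK : IsCompact (K : Set (pt s ⟶ G))) {k : pt s ⟶ G} (hk : k ∈ K) :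
    ‖ev s (χ.val k : Fn (pt s))‖ = 1 := by
  have h1 := χ.norm_ev_le_one hK hk
  have h2 := χ.norm_ev_le_one hK (K.inv_mem hk)
  have h3 : ‖ev s (χ.val k : Fn (pt s))‖ * ‖ev s (χ.val k⁻¹ : Fn (pt s))‖ = 1 := by
    rw [← norm_mul, ← map_mul, map_inv, Units.mul_inv, map_one, norm_one]
  nlinarith [norm_nonneg (ev s (χ.val k : Fn (pt s))), norm_nonneg (ev s (χ.val k⁻¹ : Fn (pt s)))]

/-- A Hermitian metric on the fibres, above `s`, of a line bundle (with total space `L`): on each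
complex line, a norm `v ↦ ‖v‖` with `‖c v‖ = |c| ‖v‖`, vanishing only at the zero vector `0 • v`.
(On a line, such a norm is the same as a Hermitian form. No regularity in the base point is recorded:
it is irrelevant for being an isometry.) -/
structure HermitianMetric (L : Scaled S) (s : Spec (.of ℂ) ⟶ S) where
  norm : (pt s ⟶ L.total) → ℝ
  nonneg : ∀ v, 0 ≤ norm v
  norm_scale : ∀ c v, norm (L.scale c v) = ‖ev s c‖ * norm v
  eq_zero : ∀ v, norm v = 0 → L.scale 0 v = v

/-- A `(G, K)`-torsor on `B`: a `G`-torsor on `B`, locally trivial for the Zariski topology, with,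
for each complex point `s` of `S`, a reduction of the structure group of `T_s(ℂ) ⟶ B_s(ℂ)` to `K s`
for the complex topology (equivalently, a continuous section of the quotient of `T_s(ℂ)` by `K s`):
`red s` is the set of `K s`-admissible frames, it consists of a single `K s`-orbit in each fibre, and
there are continuous local sections in `red s`. Two such local sections differ by a
transition function with values in `K s`. -/
structure ArithTorsor (K : ∀ s : Spec (.of ℂ) ⟶ S, Subgroup (pt s ⟶ G)) (B : Over S)
    extends GTorsor G B where
  red : ∀ s : Spec (.of ℂ) ⟶ S, Set (pt s ⟶ total)
  smul_mem : ∀ s, ∀ k ∈ K s, ∀ t ∈ red s, act.smul k t ∈ red s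
  exists_smul_eq : ∀ s, ∀ t ∈ red s, ∀ t' ∈ red s, t ≫ proj = t' ≫ proj →
    ∃ k ∈ K s, act.smul k t = t'
  exists_local_section : ∀ s (b : pt s ⟶ B), ∃ (O : Set (pt s ⟶ B)) (τ : O → (pt s ⟶ total)),
    IsOpen O ∧ b ∈ O ∧ Continuous τ ∧ ∀ b' : O, τ b' ∈ red s ∧ τ b' ≫ proj = b'

/-- For each complex point `s` of `S`, a Hermitian metric which is invariant under `K s`. -/
structure InvMetric (K : ∀ s : Spec (.of ℂ) ⟶ S, Subgroup (pt s ⟶ G)) (L : GScaled G) where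
  met : ∀ s, HermitianMetric L.toScaled s
  norm_smul : ∀ s, ∀ k ∈ K s, ∀ v, (met s).norm (L.act.smul k v) = (met s).norm v

namespace ArithTorsor
variable {K : ∀ s : Spec (.of ℂ) ⟶ S, Subgroup (pt s ⟶ G)} (T : ArithTorsor K B)
  {L : GScaled G} (m : InvMetric K L)

/-- Each complex point of a twist is `[x, u]` in some chart, and some translate `g • τ(u)` of the
algebraic frame `τ(u)` is admissible. -/
lemma exists_frame {X : Over S} (a : GAction G X) {s : Spec (.of ℂ) ⟶ S}
    (v : pt s ⟶ T.twist a) :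
    ∃ (i : T.toGTorsor.Triv) (x : pt s ⟶ X) (u : pt s ⟶ i.dom) (g : pt s ⟶ G),
      v = lift x u ≫ T.chart a i ∧ T.act.smul g (u ≫ i.sec) ∈ T.red s := by
  let b := v ≫ T.twProj a
  have hw (w w' : (pt s).left) : w = w' := Subsingleton.elim (α := PrimeSpectrum ℂ) w w'
  let w : (pt s).left := (⊥ : PrimeSpectrum ℂ)
  obtain ⟨U, hU, τ, hτ⟩ := T.exists_section (b.left w)
  obtain ⟨u, hu⟩ := GTorsor.exists_opn_lift b U (fun y ↦ by rw [hw y w]; exact hU)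
  let i : T.toGTorsor.Triv := ⟨U, τ, hτ⟩
  obtain ⟨x, hx⟩ := GTorsor.exists_chart_of_proj a v i u hu.symm
  obtain ⟨O, τ', -, hb, -, hτ'⟩ := T.exists_local_section s b
  obtain ⟨h1, h2⟩ := hτ' ⟨b, hb⟩
  obtain ⟨g, hg, -⟩ := T.existsUnique_smul (u ≫ i.sec) (τ' ⟨b, hb⟩) (by
    rw [h2, Category.assoc, i.sec_proj, hu])
  exact ⟨i, x, u, g, hx, by rw [hg]; exact h1⟩

/-- The norm on the complex points of the twist of `L`: a point reading `[x, u]` in the chart of the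
algebraic frame `τ` reads `g • x` in the admissible frame `g • τ(u)`, and its norm is `‖g • x‖`. -/
def twNorm (s : Spec (.of ℂ) ⟶ S) (v : pt s ⟶ T.twist L.act) : ℝ :=
  (m.met s).norm (L.act.smul (T.exists_frame L.act v).choose_spec.choose_spec.choose_spec.choose
    (T.exists_frame L.act v).choose_spec.choose)

/-- The norm on the twist may be computed with any chart and any admissible frame. -/
lemma twNorm_chart {s : Spec (.of ℂ) ⟶ S} (i : T.toGTorsor.Triv) (x : pt s ⟶ L.total)
    (u : pt s ⟶ i.dom) (g : pt s ⟶ G) (hg : T.act.smul g (u ≫ i.sec) ∈ T.red s) :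
    T.twNorm m s (lift x u ≫ T.chart L.act i) = (m.met s).norm (L.act.smul g x) := by
  let v := lift x u ≫ T.chart L.act i
  obtain ⟨h1, h2⟩ := (T.exists_frame L.act v).choose_spec.choose_spec.choose_spec.choose_spec
  change (m.met s).norm (L.act.smul (T.exists_frame L.act v).choose_spec.choose_spec.choose_spec.choose
    (T.exists_frame L.act v).choose_spec.choose) = _
  generalize (T.exists_frame L.act v).choose_spec.choose_spec.choose_spec.choose = g' at *
  generalize (T.exists_frame L.act v).choose_spec.choose_spec.choose = u' at *
  generalize (T.exists_frame L.act v).choose_spec.choose = x' at *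
  generalize (T.exists_frame L.act v).choose = j at *
  obtain ⟨h, hh, rfl⟩ := GTorsor.eq_smul_of_chart_eq L.act h1
  have hu := GTorsor.chart_proj_eq L.act h1
  obtain ⟨k, hk, hkg⟩ := T.exists_smul_eq s _ hg _ h2 (by
    rw [T.smul_proj, T.smul_proj, Category.assoc, Category.assoc, i.sec_proj, j.sec_proj, hu])
  rw [← hh, ← T.act.mul_smul, ← T.act.mul_smul] at hkg
  have e : k * g = g' * h := (T.existsUnique_smul (u ≫ i.sec) _ (by
    rw [T.smul_proj])).unique hkg rfl
  rw [← L.act.mul_smul, ← e, L.act.mul_smul, m.norm_smul s k hk]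

/-- The Hermitian metric on the twist: in any local trivialization of `T_s(ℂ)` by admissible frames
it is the given `K s`-invariant metric on `L`. -/
def twMetric (s : Spec (.of ℂ) ⟶ S) : HermitianMetric (T.twScaled L) s where
  norm := T.twNorm m s
  nonneg v := (m.met s).nonneg _
  norm_scale c v := by
    obtain ⟨i, x, u, g, rfl, hg⟩ := T.exists_frame L.act v
    rw [T.twNorm_chart m i x u g hg]
    refine (congrArg (T.twNorm m s) (T.twScale_chart L c i x u)).trans ?_
    rw [T.twNorm_chart m i _ u g hg, L.smul_scale, (m.met s).norm_scale]
  eq_zero v hv := by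
    obtain ⟨i, x, u, g, rfl, hg⟩ := T.exists_frame L.act v
    rw [T.twNorm_chart m i x u g hg] at hv
    have h := (m.met s).eq_zero _ hv
    rw [← L.smul_scale] at h
    have h' := congrArg (L.act.smul g⁻¹) h
    rw [← L.act.mul_smul, ← L.act.mul_smul, inv_mul_cancel, L.act.one_smul, L.act.one_smul] at h'
    exact (T.twScale_chart L 0 i x u).trans (by rw [h'])

end ArithTorsor

namespace Character
variable (χ : Character G) {K : ∀ s : Spec (.of ℂ) ⟶ S, Subgroup (pt s ⟶ G)}
  (hK : ∀ s, IsMaximalCompact (K s))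

/-- The Hermitian metric `|t|` on the representation `χ`; it is `K s`-invariant. -/
def repMetric : InvMetric K χ.rep where
  met s :=
    { norm := fun x ↦ ‖ev s (coord x)‖
      nonneg := fun _ ↦ norm_nonneg _
      norm_scale := fun c x ↦ by rw [coord_ofCoord, map_mul, norm_mul]
      eq_zero := fun x hx ↦ by
        have h : coord x = 0 := ev_injective s (by rw [norm_eq_zero.1 hx, map_zero])
        change ofCoord (0 * coord x) = x
        rw [zero_mul, ← h, ofCoord_coord] }
  norm_smul s k hk x := by
    change ‖ev s (coord (ofCoord (χ.val k * coord x)))‖ = ‖ev s (coord x)‖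
    rw [coord_ofCoord, map_mul, norm_mul, χ.norm_ev_eq_one (hK s).isCompact hk, _root_.one_mul]

/-- The trivial metric `‖(t, x)‖ = |t|` on `ι(χ)`; it is `K s`-invariant. -/
def iotaMetric {X : Over S} (a : GAction G X) : InvMetric K (χ.iota a).toGScaled where
  met s :=
    { norm := fun v ↦ ‖ev s (coord (v ≫ fst (A1 S) X))‖
      nonneg := fun _ ↦ norm_nonneg _
      norm_scale := fun c v ↦ by
        dsimp [iota]
        rw [lift_fst, coord_ofCoord, map_mul, norm_mul]
      eq_zero := fun v hv ↦ by
        have h : coord (v ≫ fst (A1 S) X) = 0 :=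
          ev_injective s (by rw [norm_eq_zero.1 hv, map_zero])
        change lift (ofCoord (0 * coord (v ≫ fst (A1 S) X))) (v ≫ snd (A1 S) X) = v
        rw [zero_mul, ← h, ofCoord_coord]
        exact lift_comp_fst_snd v }
  norm_smul s k hk v := by
    dsimp [iota, actProd]
    rw [lift_fst, coord_ofCoord, map_mul, norm_mul, χ.norm_ev_eq_one (hK s).isCompact hk,
      _root_.one_mul]

end Character

namespace LineBundle

/-- The pull-back of a Hermitian metric. -/
def pullMetric {Y Y' : Over S} (L : LineBundle Y) (p : Y' ⟶ Y) {s : Spec (.of ℂ) ⟶ S}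
    (m : HermitianMetric L.toScaled s) : HermitianMetric (L.pull p).toScaled s where
  norm v := m.norm (v ≫ pullback.fst L.proj p)
  nonneg v := m.nonneg _
  norm_scale c v := (congrArg m.norm (pbScale_fst L p c v)).trans (m.norm_scale c _)
  eq_zero v hv := by
    apply pullback.hom_ext
    · exact (pbScale_fst L p 0 v).trans (m.eq_zero _ hv)
    · exact pbScale_snd L p 0 v

/-- Isomorphisms of line bundles on `Y`. -/
structure Iso {Y : Over S} (L L' : LineBundle Y) where
  iso : L.total ≅ L'.total
  proj : iso.hom ≫ L'.proj = L.proj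
  scale : ∀ {W : Over S} (c : Fn W) (v : W ⟶ L.total),
    L.scale c v ≫ iso.hom = L'.scale c (v ≫ iso.hom)

/-- The isomorphism `e` is an isometry. -/
def Iso.IsIsometry {Y : Over S} {L L' : LineBundle Y} (e : Iso L L') {s : Spec (.of ℂ) ⟶ S}
    (m : HermitianMetric L.toScaled s) (m' : HermitianMetric L'.toScaled s) : Prop :=
  ∀ v : pt s ⟶ L.total, m'.norm (v ≫ e.iso.hom) = m.norm v

end LineBundle

/-- The isomorphism `ϑ(ι(χ)) ≅ π^* η_T(χ)` is the canonical one: for each trivialization of `T` with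
domain `U`, it is the identity in the charts `𝔸¹ × X × U` of both sides, that is, it maps
`[(t, x), u]` to the pair `([t, u], [x, u])`. -/
def IsCanonical (T : GTorsor G B) {X : Over S} (a : GAction G X) (χ : Character G)
    (e : LineBundle.Iso (T.theta (χ.iota a)) ((χ.eta T).pull (T.twProj a))) : Prop :=
  ∀ (i : T.Triv) {W : Over S} (t : W ⟶ A1 S) (x : W ⟶ X) (u : W ⟶ i.dom),
    (lift (lift t x) u ≫ T.chart (χ.actProd a) i) ≫ e.iso.hom =
      pullback.lift (lift t u ≫ T.chart χ.actA1 i) (lift x u ≫ T.chart a i)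
        (by
          change (lift t u ≫ T.chart χ.actA1 i) ≫ T.twProj χ.actA1 = _
          rw [Category.assoc, Category.assoc, GTorsor.chart_proj, GTorsor.chart_proj,
            lift_snd_assoc, lift_snd_assoc])

end TorsorTwist

end

open TorsorTwist NumberField

open CategoryTheory Limits AlgebraicGeometry MonoidalCategory CartesianMonoidalCategory MonObj

/-! ### Isomorphisms of schemes and of line bundles checked locally. -/

namespace TorsorTwist
variable {S : Scheme.{0}}

/-! Twisting by `T` is functorial in `G`-equivariant morphisms and compatible with products: the
twist of `𝔸¹ × X` is the fibre product over `B` of the twists of `𝔸¹` and of `X`. The total space of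
`ϑ(ι(χ))` is the former and that of `π^* η_T(χ)` is the latter, so the theorem amounts to this
identification, together with its compatibility with scalings and norms.

The two projections of `𝔸¹ × X` are equivariant, hence induce `twFst` and `twSnd`, and with them the
comparison morphism `[(t, x), u] ↦ ([t, u], [x, u])`, which is `thetaIotaHom`. No inverse is glued
by hand from charts. Two points with the same image lie over the same point of `B`, so they read in
one chart, where their coordinates agree: the morphism is a monomorphism. Any point of the fibre
product is locally `([t, u], [x, u])` with a common chart and a common `u`, hence lifts. A
monomorphism with local lifts is an isomorphism, because the lifts are unique and glue
(`isIso_of_mono_of_local_sections`).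

Linearity holds because the scaling of `ι(χ)` touches only the coordinate `t`. Uniqueness holds
because the charts cover the twist, so that being the identity in charts determines the morphism.

For the isometry, choose at a complex point a chart with algebraic frame `τ` and a `g` such that `g
• τ(u)` is admissible. Both norms may be computed with this same frame (`ArithTorsor.twNorm_chart`),
and both equal `|χ(g) t|`. Compactness of `K s` enters through `|χ| = 1` on `K s`, which makes the
metrics `|t|` invariant. -/

/-- A monomorphism that admits sections locally on its target is an isomorphism. -/
lemma isIso_of_mono_of_local_sections {Z P : Over S} (φ : Z ⟶ P) [Mono φ]
    (h : ∀ p : P.left, ∃ O : P.left.Opens, p ∈ O ∧ ∃ y : opn P O ⟶ Z, y ≫ φ = incl P O) :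
    IsIso φ := by
  -- The property glued is "`y` lifts `f` through `φ`"; such lifts are unique since `φ` is mono, so
  -- the local ones glue to a section of `φ`.
  obtain ⟨y, hy⟩ := GTorsor.exists_glue (W := P) (Y := Z) (fun f y ↦ y ≫ φ = f)
    (fun k f y hf ↦ by rw [Category.assoc, hf])
    (fun f y y' e e' ↦ (cancel_mono φ).1 (e.trans e'.symm)) h
  have hyφ : y ≫ φ = 𝟙 P := GTorsor.hom_ext_local _ _ fun p ↦ by
    obtain ⟨O, hO, y', hy'⟩ := h p
    exact ⟨O, hO, by rw [← Category.assoc, hy _ y' hy', hy', Category.comp_id]⟩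
  exact ⟨y, by rw [← cancel_mono φ, Category.assoc, hyφ, Category.comp_id, Category.id_comp], hyφ⟩

/-- The remaining fields are propositions, and an isomorphism of schemes is determined by its
forward direction. -/
lemma LineBundle.Iso.ext_hom {Y : Over S} {L L' : LineBundle Y} {e e' : LineBundle.Iso L L'}
    (h : e.iso.hom = e'.iso.hom) : e = e' := by
  have hiso : e.iso = e'.iso := CategoryTheory.Iso.ext h
  cases e
  cases e'
  cases hiso
  rfl

variable {G B X : Over S} [GrpObj G]

/-! ### The comparison morphism: construction, bijectivity, linearity. -/

namespace Character
variable (T : GTorsor G B) (a : GAction G X) (χ : Character G)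

/-- Equivariance of the two projections (here and in `actProd_smul_snd`) is what allows them to be
twisted by `T`. -/
lemma actProd_smul_fst {W : Over S} (g : W ⟶ G) (z : W ⟶ A1 S ⊗ X) :
    (χ.actProd a).smul g z ≫ fst (A1 S) X = χ.actA1.smul g (z ≫ fst (A1 S) X) :=
  lift_fst _ _

lemma actProd_smul_snd {W : Over S} (g : W ⟶ G) (z : W ⟶ A1 S ⊗ X) :
    (χ.actProd a).smul g z ≫ snd (A1 S) X = a.smul g (z ≫ snd (A1 S) X) :=
  lift_snd _ _

/-- The morphism `[(t, x), u] ↦ [t, u]` from the twist of `𝔸¹ × X` to that of `𝔸¹`. -/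
noncomputable def twFst : T.twist (χ.actProd a) ⟶ T.twist χ.actA1 :=
  T.twHom (χ.actProd a) χ.actA1 (fst (A1 S) X) (χ.actProd_smul_fst a)

/-- The morphism `[(t, x), u] ↦ [x, u]` from the twist of `𝔸¹ × X` to that of `X`. -/
noncomputable def twSnd : T.twist (χ.actProd a) ⟶ T.twist a :=
  T.twHom (χ.actProd a) a (snd (A1 S) X) (χ.actProd_smul_snd a)

/-- The morphism `[(t, x), u] ↦ ([t, u], [x, u])`. -/
noncomputable def thetaIotaHom : T.twist (χ.actProd a) ⟶ pullback (T.twProj χ.actA1) (T.twProj a) :=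
  pullback.lift (χ.twFst T a) (χ.twSnd T a) (by
    rw [twFst, twSnd, GTorsor.twHom_proj, GTorsor.twHom_proj])

variable {T}

/-- `twHom` comes from a gluing argument by choice, so its value in charts is the handle for
computing with it. -/
lemma chart_twFst {W : Over S} (i : T.Triv) (z : W ⟶ A1 S ⊗ X) (u : W ⟶ i.dom) :
    (lift z u ≫ T.chart (χ.actProd a) i) ≫ χ.twFst T a =
      lift (z ≫ fst _ _) u ≫ T.chart χ.actA1 i :=
  T.chart_twHom _ _ _ (χ.actProd_smul_fst a) i z u

lemma chart_twSnd {W : Over S} (i : T.Triv) (z : W ⟶ A1 S ⊗ X) (u : W ⟶ i.dom) :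
    (lift z u ≫ T.chart (χ.actProd a) i) ≫ χ.twSnd T a = lift (z ≫ snd _ _) u ≫ T.chart a i :=
  T.chart_twHom _ _ _ (χ.actProd_smul_snd a) i z u

lemma thetaIotaHom_fst : χ.thetaIotaHom T a ≫ pullback.fst _ _ = χ.twFst T a :=
  pullback.lift_fst _ _ _

lemma thetaIotaHom_snd : χ.thetaIotaHom T a ≫ pullback.snd _ _ = χ.twSnd T a :=
  pullback.lift_snd _ _ _

/-- Used to see that the second component of a point already determines its image in `B`, hence
which charts contain it. -/
lemma twSnd_proj : χ.twSnd T a ≫ T.twProj a = T.twProj (χ.actProd a) :=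
  T.twHom_proj _ _ _ (χ.actProd_smul_snd a)

/-- Injectivity on points is local on the source and reduces to a single chart, where the morphism
is `((t, x), u) ↦ ((t, u), (x, u))`. -/
instance mono_thetaIotaHom : Mono (χ.thetaIotaHom T a) := by
  refine ⟨fun {W} v v' h ↦ GTorsor.hom_ext_local _ _ fun w ↦ ?_⟩
  have h1 : v ≫ χ.twFst T a = v' ≫ χ.twFst T a := by
    rw [← thetaIotaHom_fst, ← Category.assoc, h, Category.assoc]
  have h2 : v ≫ χ.twSnd T a = v' ≫ χ.twSnd T a := by
    rw [← thetaIotaHom_snd, ← Category.assoc, h, Category.assoc]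
  obtain ⟨O, hO, i, z, u, hz⟩ := GTorsor.exists_chart (χ.actProd a) v w
  refine ⟨O, hO, ?_⟩
  -- By `h2` the points `v` and `v'` have the same image in `B`, so `v'` also reads in the chart
  -- `i`, with the same `u`.
  obtain ⟨z', hz'⟩ := GTorsor.exists_chart_of_proj (χ.actProd a) (incl W O ≫ v') i u (by
    rw [← twSnd_proj, Category.assoc, ← Category.assoc v', ← h2, Category.assoc, twSnd_proj,
      ← Category.assoc, hz, Category.assoc, GTorsor.chart_proj, lift_snd_assoc])
  have e1 := congrArg (incl W O ≫ ·) h1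
  have e2 := congrArg (incl W O ≫ ·) h2
  simp only [← Category.assoc] at e1 e2
  rw [hz, hz', chart_twFst, chart_twFst] at e1
  rw [hz, hz', chart_twSnd, chart_twSnd] at e2
  have ez : z = z' :=
    CartesianMonoidalCategory.hom_ext _ _ (GTorsor.chart_cancel _ e1).1 (GTorsor.chart_cancel _ e2).1
  rw [hz, hz', ez]

/-- Local lifts suffice. A chart is chosen for the second component of the universal point of the
fibre product, and it serves for the first component too. -/
instance isIso_thetaIotaHom : IsIso (χ.thetaIotaHom T a) := by
  refine isIso_of_mono_of_local_sections _ fun p ↦ ?_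
  obtain ⟨O, hO, i, x, u, hx⟩ :=
    GTorsor.exists_chart a (pullback.snd (T.twProj χ.actA1) (T.twProj a)) p
  -- Both components have the same image in `B`, so the first one is `[t, u]` with the `i` and `u`
  -- found for the second.
  obtain ⟨t, ht⟩ := GTorsor.exists_chart_of_proj χ.actA1
    (incl _ O ≫ pullback.fst (T.twProj χ.actA1) (T.twProj a)) i u (by
      rw [Category.assoc, pullback.condition, ← Category.assoc, hx, Category.assoc,
        GTorsor.chart_proj, lift_snd_assoc])
  refine ⟨O, hO, lift (lift t x) u ≫ T.chart (χ.actProd a) i, pullback.hom_ext ?_ ?_⟩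
  · rw [Category.assoc, thetaIotaHom_fst, chart_twFst, lift_fst, ht]
  · rw [Category.assoc, thetaIotaHom_snd, chart_twSnd, lift_snd, hx]

/-- Both scalings are computed in charts, where `c • (t, x) = (c t, x)` has first coordinate `c t`.
-/
lemma twScale_twFst {W : Over S} (c : Fn W) (v : W ⟶ T.twist (χ.actProd a)) :
    T.twScale (χ.iota a).toGScaled c v ≫ χ.twFst T a = T.twScale χ.rep c (v ≫ χ.twFst T a) := by
  refine GTorsor.hom_ext_local _ _ fun w ↦ ?_
  obtain ⟨O, hO, i, z, u, hz⟩ := GTorsor.exists_chart (χ.actProd a) v w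
  refine ⟨O, hO, (Category.assoc _ _ _).symm.trans ?_⟩
  have h1 := T.comp_twScale (χ.iota a).toGScaled c v _ i z u hz
  have h2 := T.comp_twScale χ.rep c (v ≫ χ.twFst T a) (incl W O) i (z ≫ fst _ _) u (by
    rw [← Category.assoc, hz]; exact χ.chart_twFst a i z u)
  refine (congrArg (· ≫ χ.twFst T a) h1).trans (((χ.chart_twFst a i _ u).trans ?_).trans h2.symm)
  congr 2
  exact lift_fst _ _

/-- By definition `twSnd` is the bundle projection of `ϑ(ι(χ))`, and scaling preserves fibres. -/
lemma twScale_twSnd {W : Over S} (c : Fn W) (v : W ⟶ T.twist (χ.actProd a)) :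
    T.twScale (χ.iota a).toGScaled c v ≫ χ.twSnd T a = v ≫ χ.twSnd T a :=
  (T.theta (χ.iota a)).scale_proj c v

/-! ### The isomorphism of line bundles and its form in charts. -/

variable (T)

/-- `thetaIotaHom` as an isomorphism of schemes. -/
noncomputable def thetaIotaTotalIso :
    T.twist (χ.actProd a) ≅ pullback (T.twProj χ.actA1) (T.twProj a) :=
  asIso (χ.thetaIotaHom T a)

/-- The isomorphism `ϑ(ι(χ)) ≅ π^* η_T(χ)`, `[(t, x), u] ↦ ([t, u], [x, u])`. -/
noncomputable def thetaIotaIso : LineBundle.Iso (T.theta (χ.iota a)) ((χ.eta T).pull (T.twProj a)) where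
  iso := χ.thetaIotaTotalIso T a
  proj := χ.thetaIotaHom_snd a
  scale c v := by
    -- Scaling on the pull-back acts on the factor `η_T(χ)` alone, so the two components are
    -- `twScale_twFst` and `twScale_twSnd`.
    apply pullback.hom_ext
    · refine (Category.assoc _ _ _).trans ((congrArg _ (χ.thetaIotaHom_fst a)).trans
        ((χ.twScale_twFst a c v).trans ?_))
      refine Eq.trans ?_ ((χ.eta T).pbScale_fst (T.twProj a) c (v ≫ χ.thetaIotaHom T a)).symm
      exact congrArg (T.twScale χ.rep c)
        ((congrArg (v ≫ ·) (χ.thetaIotaHom_fst a)).symm.trans (Category.assoc _ _ _).symm)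
    · refine (Category.assoc _ _ _).trans ((congrArg _ (χ.thetaIotaHom_snd a)).trans
        ((χ.twScale_twSnd a c v).trans ?_))
      refine Eq.trans ?_ ((χ.eta T).pbScale_snd (T.twProj a) c (v ≫ χ.thetaIotaHom T a)).symm
      exact (congrArg (v ≫ ·) (χ.thetaIotaHom_snd a)).symm.trans (Category.assoc _ _ _).symm

lemma isCanonical_thetaIotaIso : IsCanonical T a χ (χ.thetaIotaIso T a) := by
  intro i W t x u
  apply pullback.hom_ext
  · refine (Category.assoc _ _ _).trans ((congrArg (_ ≫ ·) (χ.thetaIotaHom_fst a)).trans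
      ((χ.chart_twFst a i (lift t x) u).trans ?_))
    rw [lift_fst]
    exact (pullback.lift_fst _ _ _).symm
  · refine (Category.assoc _ _ _).trans ((congrArg (_ ≫ ·) (χ.thetaIotaHom_snd a)).trans
      ((χ.chart_twSnd a i (lift t x) u).trans ?_))
    rw [lift_snd]
    exact (pullback.lift_snd _ _ _).symm

end Character

/-! ### Uniqueness and isometry of canonical isomorphisms. -/

variable {T : GTorsor G B} {a : GAction G X} {χ : Character G}

/-- Locally the universal point of the twist of `𝔸¹ × X` has the form `[(t, x), u]`, and canonicity
prescribes its image. -/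
lemma IsCanonical.unique
    {e e' : LineBundle.Iso (T.theta (χ.iota a)) ((χ.eta T).pull (T.twProj a))}
    (h : IsCanonical T a χ e) (h' : IsCanonical T a χ e') : e = e' := by
  refine LineBundle.Iso.ext_hom (GTorsor.hom_ext_local _ _ fun w ↦ ?_)
  obtain ⟨O, hO, i, z, u, hz⟩ := GTorsor.exists_chart (χ.actProd a) (𝟙 _) w
  refine ⟨O, hO, ?_⟩
  rw [Category.comp_id] at hz
  obtain ⟨t, x, rfl⟩ : ∃ t x, z = lift t x := ⟨_, _, (lift_comp_fst_snd z).symm⟩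
  exact (congrArg (· ≫ e.iso.hom) hz).trans
    ((h i t x u).trans ((h' i t x u).symm.trans (congrArg (· ≫ e'.iso.hom) hz).symm))

/-- Only the formula in charts is used, so the argument applies to any canonical `e`, without
reference to its construction. -/
lemma IsCanonical.isIsometry {K : ∀ s : Spec (.of ℂ) ⟶ S, Subgroup (pt s ⟶ G)}
    (hK : ∀ s, IsMaximalCompact (K s)) {T : ArithTorsor K B}
    {e : LineBundle.Iso (T.theta (χ.iota a)) ((χ.eta T.toGTorsor).pull (T.twProj a))}
    (h : IsCanonical T.toGTorsor a χ e) (s : Spec (.of ℂ) ⟶ S) :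
    e.IsIsometry (T.twMetric (χ.iotaMetric hK a) s)
      ((χ.eta T.toGTorsor).pullMetric (T.twProj a) (T.twMetric (χ.repMetric hK) s)) := by
  intro v
  obtain ⟨i, z, u, g, rfl, hg⟩ := T.exists_frame (χ.actProd a) v
  obtain ⟨t, x, rfl⟩ : ∃ t x, z = lift t x := ⟨_, _, (lift_comp_fst_snd z).symm⟩
  -- The admissible frame `g • τ(u)` depends on `T` only, so one `g` computes the norms on both
  -- twists.
  have h1 := T.twNorm_chart (χ.iotaMetric hK a) i (lift t x) u g hg
  have h2 := T.twNorm_chart (χ.repMetric hK) i t u g hg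
  have h3 := congrArg (· ≫ pullback.fst (T.twProj χ.actA1) (T.twProj a)) (h i t x u)
  refine (congrArg (T.twNorm (χ.repMetric hK) s)
    (h3.trans (pullback.lift_fst _ _ _))).trans (h2.trans (Eq.trans ?_ h1.symm))
  -- Both sides are `|χ(g) t|`: on `𝔸¹ × X` the norm sees only the first coordinate, on which `g`
  -- acts through `χ`.
  change ‖ev s (coord (χ.actA1.smul g t))‖ = ‖ev s (coord (lift (χ.actA1.smul g (lift t x ≫ fst _ _))
    (a.smul g (lift t x ≫ snd _ _)) ≫ fst (A1 S) X))‖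
  rw [lift_fst, lift_fst]

end TorsorTwist

open TorsorTwist NumberField

theorem mainTheorem10 {F : Type} [Field F] [NumberField F]
    (G : Over (Spec (.of (𝓞 F)))) [GrpObj G] [IsAffineHom G.hom] [LocallyOfFiniteType G.hom]
    [Flat G.hom] [GeometricallyConnected G.hom]
    (K : ∀ s : Spec (.of ℂ) ⟶ Spec (.of (𝓞 F)), Subgroup (pt s ⟶ G))
    (hK : ∀ s, IsMaximalCompact (K s))
    (X : Over (Spec (.of (𝓞 F)))) [Flat X.hom] (a : GAction G X)
    (B : Over (Spec (.of (𝓞 F)))) [Flat B.hom] (T : ArithTorsor K B) (χ : Character G) :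
    (∃! e : LineBundle.Iso (T.theta (χ.iota a)) ((χ.eta T.toGTorsor).pull (T.twProj a)),
      IsCanonical T.toGTorsor a χ e) ∧
    ∀ e : LineBundle.Iso (T.theta (χ.iota a)) ((χ.eta T.toGTorsor).pull (T.twProj a)),
      IsCanonical T.toGTorsor a χ e → ∀ s : Spec (.of ℂ) ⟶ Spec (.of (𝓞 F)),
        e.IsIsometry (T.twMetric (χ.iotaMetric hK a) s)
          ((χ.eta T.toGTorsor).pullMetric (T.twProj a) (T.twMetric (χ.repMetric hK) s)) := by
  refine ⟨⟨χ.thetaIotaIso T.toGTorsor a, χ.isCanonical_thetaIotaIso T.toGTorsor a,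
    fun e he ↦ he.unique (χ.isCanonical_thetaIotaIso T.toGTorsor a)⟩,
    fun e he s ↦ he.isIsometry hK s⟩
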